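/- Let $q(t)\in\mathbb{C}[t]$ be a polynomial of degree $n\ge 4$. Put $\rho=2q(-\tfrac12)$ and \[ p(t)=\frac{-4q(t)q(-t-1)+\rho^2}{(1+2t)^2}, \] which is a polynomial in $\mathbb{C}[t]$, and let $p_0,p_1\in\mathbb{C}[t]$ be determined by $p(t)=p_0(t^2)+p_1(t^2)t$. Let $D(q)$ (the noncommutative Kleinian singularity of type $D$) be the associative unital $\mathbb{C}$-algebra with generators $u,v,w$ and defining relations \[ [u,v]=2w+v,\qquad [u,w]=2vu+w+\rho,\qquad [v,w]=-v^2-p_1(u),\qquad w^2=v^2u+vw+\rho v+p_0(u), \] where $[x,y]=xy-yx$. Then the subalgebra $\mathbb{C}[u]$ of $D(q)$ generated by $u$ is maximal commutative in $D(q)$: it is commutative, and no commutative subalgebra of $D(q)$ properly contains it. -/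

import Mathlib

open Polynomial

namespace KleinianD

noncomputable section

/-- The constant `ρ = 2 q(-1/2)`. -/
def rho (q : ℂ[X]) : ℂ := 2 * q.eval (-(1 / 2))

/-- The polynomial `p(t) = (-4 q(t) q(-t-1) + ρ²) / (1+2t)²`. The division is exact,
see `pPoly_mul`. -/
def pPoly (q : ℂ[X]) : ℂ[X] :=
  (-4 * q * q.comp (-X - 1) + C (rho q ^ 2)) / (1 + 2 * X) ^ 2

/-- The polynomial `p₀` in `p(t) = p₀(t²) + p₁(t²) t`. -/
def p0 (q : ℂ[X]) : ℂ[X] := (pPoly q).contract 2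

/-- The polynomial `p₁` in `p(t) = p₀(t²) + p₁(t²) t`. -/
def p1 (q : ℂ[X]) : ℂ[X] := (pPoly q).divX.contract 2

/-- The names of the three generators. -/
inductive Gen : Type
  | u
  | v
  | w

/-- The generator `u` of the free algebra on `u, v, w`. -/
abbrev fu : FreeAlgebra ℂ Gen := FreeAlgebra.ι ℂ Gen.u

/-- The generator `v` of the free algebra on `u, v, w`. -/
abbrev fv : FreeAlgebra ℂ Gen := FreeAlgebra.ι ℂ Gen.v

/-- The generator `w` of the free algebra on `u, v, w`. -/
abbrev fw : FreeAlgebra ℂ Gen := FreeAlgebra.ι ℂ Gen.w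

/-- The defining relations of `D(q)`. -/
inductive Rel (q : ℂ[X]) : FreeAlgebra ℂ Gen → FreeAlgebra ℂ Gen → Prop
  | uv : Rel q (fu * fv - fv * fu) (2 * fw + fv)
  | uw : Rel q (fu * fw - fw * fu)
      (2 * (fv * fu) + fw + algebraMap ℂ (FreeAlgebra ℂ Gen) (rho q))
  | vw : Rel q (fv * fw - fw * fv) (-fv ^ 2 - aeval fu (p1 q))
  | ww : Rel q (fw ^ 2) (fv ^ 2 * fu + fv * fw + rho q • fv + aeval fu (p0 q))

/-- The noncommutative type `D` Kleinian singularity `D(q)`: the unital associative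
`ℂ`-algebra with generators `u, v, w` and the relations `Rel q`. -/
abbrev D (q : ℂ[X]) : Type := RingQuot (Rel q)

/-- The generator `u` of `D(q)`. -/
def u (q : ℂ[X]) : D q := RingQuot.mkAlgHom ℂ (Rel q) fu

/-- The generator `v` of `D(q)`. -/
def v (q : ℂ[X]) : D q := RingQuot.mkAlgHom ℂ (Rel q) fv

/-- The generator `w` of `D(q)`. -/
def w (q : ℂ[X]) : D q := RingQuot.mkAlgHom ℂ (Rel q) fw

/-- The subalgebra `ℂ[u]` of `D(q)` generated by `u`. -/
def Cu (q : ℂ[X]) : Subalgebra ℂ (D q) := Algebra.adjoin ℂ {u q}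

/-- A subalgebra is maximal commutative if it is commutative and no commutative subalgebra
properly contains it. -/
def IsMaximalCommutative {A : Type*} [Ring A] [Algebra ℂ A] (B : Subalgebra ℂ A) : Prop :=
  Maximal (fun S : Subalgebra ℂ A => IsMulCommutative S) B

theorem pPoly_mul (q : ℂ[X]) :
    pPoly q * (1 + 2 * X) ^ 2 = -4 * q * q.comp (-X - 1) + C (rho q ^ 2) := by
  set N : ℂ[X] := -4 * q * q.comp (-X - 1) + C (rho q ^ 2) with hN
  have hroot : N.eval (-(1 / 2)) = 0 := by
    simp only [hN, rho, eval_add, eval_mul, eval_comp, eval_sub, eval_neg, eval_X, eval_one,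
      eval_C, eval_ofNat]
    have : (- -(1 / 2) - 1 : ℂ) = -(1 / 2) := by norm_num
    rw [this]; ring
  have hsymm : N.comp (-X - 1) = N := by
    have h : ((-X - 1 : ℂ[X])).comp (-X - 1) = X := by
      simp
    simp only [hN, add_comp, mul_comp, neg_comp, C_comp, comp_assoc, h, comp_X, ofNat_comp]
    ring
  have hlin : (1 + 2 * X : ℂ[X]) = C 2 * (X - C (-(1 / 2))) := by
    rw [mul_sub, ← C_mul]; norm_num; rw [show (C 2 : ℂ[X]) = 2 from rfl]; ring
  obtain ⟨M, hM⟩ := dvd_iff_isRoot.mpr (show N.IsRoot (-(1 / 2)) from hroot)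
  have hMr : M.eval (-(1 / 2)) = 0 := by
    have hd : N.derivative.eval (-(1 / 2)) = 0 := by
      have := congrArg (fun f => (derivative f).eval (-(1 / 2) : ℂ)) hsymm
      simp only [derivative_comp, eval_mul, eval_comp, derivative_sub, derivative_neg,
        derivative_X, derivative_one, eval_sub, eval_neg, eval_X, eval_one, eval_zero] at this
      have e : (- -(1 / 2) - 1 : ℂ) = -(1 / 2) := by norm_num
      rw [e] at this
      linear_combination (-1 / 2 : ℂ) * this
    rw [hM] at hd
    simpa using hd
  obtain ⟨K, hK⟩ := dvd_iff_isRoot.mpr (show M.IsRoot (-(1 / 2)) from hMr)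
  have hdvd : (1 + 2 * X : ℂ[X]) ^ 2 ∣ N := by
    refine ⟨C (1 / 4) * K, ?_⟩
    rw [hM, hK, hlin]
    have : (C 2 * C 2 * C (1 / 4) : ℂ[X]) = 1 := by
      rw [← C_mul, ← C_mul]; norm_num
    linear_combination (-(X - C (-(1 / 2))) ^ 2 * K) * this
  rw [pPoly, ← hN, mul_comm]
  exact EuclideanDomain.mul_div_cancel' (by
    rw [hlin]; exact pow_ne_zero _ (mul_ne_zero (by simp) (X_sub_C_ne_zero _))) hdvd

theorem pPoly_eq (q : ℂ[X]) :
    pPoly q = (p0 q).comp (X ^ 2) + (p1 q).comp (X ^ 2) * X := by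
  rw [← expand_eq_comp_X_pow, ← expand_eq_comp_X_pow]
  ext n
  rcases n with _ | n
  · simp [p0, coeff_contract, coeff_expand]
  · rw [coeff_add, coeff_mul_X, coeff_expand (by norm_num), coeff_expand (by norm_num)]
    simp only [p0, p1, coeff_contract (two_ne_zero), coeff_divX]
    rcases Nat.even_or_odd n with h | h
    · have h1 : 2 ∣ n := h.two_dvd
      have h2 : ¬ 2 ∣ n + 1 := by omega
      rw [if_neg h2, if_pos h1, Nat.div_mul_cancel h1, zero_add]
    · have h2 : 2 ∣ n + 1 := h.add_one.two_dvd
      have h1 : ¬ 2 ∣ n := by omega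
      rw [if_pos h2, if_neg h1, Nat.div_mul_cancel h2, add_zero]

end

end KleinianD

open Polynomial

namespace KleinianD

noncomputable section

/-! ### The defining relations, transported to `D q`. -/

section Relations

variable (q : ℂ[X])

/-! A commutative subalgebra containing `ℂ[u]` centralizes `u`, so it suffices that the centralizer
of `u` is `ℂ[u]` (`mem_Cu_of_commute`).

The relations let `u` be moved to the left, so `D(q)` is spanned over `ℂ[u]` by the `v ^ j` and `v ^
j * w` (`exists_mem_filtration`). To control coefficients, let `D(q)` act on functions on the
lattice `s ∈ i + ℤ` (`rep`): `u` multiplies by `s²`, while `v` and `w` are three-term difference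
operators. The values `s²` are pairwise distinct, so anything commuting with `u` sends each delta
function to a multiple of itself.

If such an element has top part `f(u) v ^ (n+1) + g(u) v ^ n w`, its lowest possible coefficient on
a delta function is `f(s²) - g(s²)(s + n + 1)`, which must vanish at every lattice point `s`. The
odd part in `s` forces `g = 0`, then `f = 0` (`eq_zero_of_eval_node`), and the degree drops until
the element lies in `ℂ[u]`. Neither linear independence of the spanning set nor faithfulness of the
representation is needed. -/

theorem u_mul_v : u q * v q - v q * u q = 2 * w q + v q := by
  have h := RingQuot.mkAlgHom_rel ℂ (Rel.uv (q := q))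
  simp only [map_sub, map_mul, map_add, map_ofNat] at h
  exact h

theorem u_mul_w : u q * w q - w q * u q
    = 2 * (v q * u q) + w q + algebraMap ℂ (D q) (rho q) := by
  have h := RingQuot.mkAlgHom_rel ℂ (Rel.uw (q := q))
  simp only [map_sub, map_mul, map_add, map_ofNat, AlgHom.commutes] at h
  exact h

theorem v_mul_w : v q * w q - w q * v q = -v q ^ 2 - aeval (u q) (p1 q) := by
  have h := RingQuot.mkAlgHom_rel ℂ (Rel.vw (q := q))
  simp only [map_sub, map_mul, map_neg, map_pow, ← aeval_algHom_apply] at h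
  exact h

theorem w_sq : w q ^ 2 = v q ^ 2 * u q + v q * w q + rho q • v q + aeval (u q) (p0 q) := by
  have h := RingQuot.mkAlgHom_rel ℂ (Rel.ww (q := q))
  simp only [map_mul, map_add, map_smul, map_pow, ← aeval_algHom_apply] at h
  exact h

end Relations

/-! ### Spanning `D(q)` over `ℂ[u]`, by a degree filtration. -/

section Filtration

variable {q : ℂ[X]}

theorem mem_Cu_iff {x : D q} : x ∈ Cu q ↔ ∃ f : ℂ[X], aeval (u q) f = x := by
  rw [Cu, Algebra.adjoin_singleton_eq_range_aeval]
  rfl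

/-- The left `ℂ[u]`-submodule of `D(q)` spanned by the `v ^ j` with `j ≤ n` and the `v ^ j * w`
with `j < n`. -/
def filtration (q : ℂ[X]) : ℕ → Submodule (Cu q) (D q)
  | 0 => Submodule.span (Cu q) {1}
  | n + 1 => filtration q n ⊔ Submodule.span (Cu q) {v q ^ (n + 1), v q ^ n * w q}

theorem filtration_le_succ (n : ℕ) : filtration q n ≤ filtration q (n + 1) := le_sup_left

theorem filtration_mono : Monotone (filtration q) := monotone_nat_of_le_succ filtration_le_succ

theorem v_pow_mul_w_mem (n : ℕ) : v q ^ n * w q ∈ filtration q (n + 1) :=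
  Submodule.mem_sup_right (Submodule.subset_span (by simp))

theorem v_pow_mem : ∀ n : ℕ, v q ^ n ∈ filtration q n
  | 0 => by simp [filtration]
  | _ + 1 => Submodule.mem_sup_right (Submodule.subset_span (by simp))

theorem complex_smul_mem {n : ℕ} {x : D q} (c : ℂ) (hx : x ∈ filtration q n) :
    c • x ∈ filtration q n := by
  have := (filtration q n).smul_mem (algebraMap ℂ (Cu q) c) hx
  rwa [algebraMap_smul] at this

theorem filtration_sub_mem {n : ℕ} {x y : D q} (hx : x ∈ filtration q n)
    (hy : y ∈ filtration q n) : x - y ∈ filtration q n := by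
  have h : x - y = x + (-1 : ℂ) • y := by
    rw [Algebra.smul_def, map_neg, map_one, sub_eq_add_neg]
    exact congrArg (x + ·) (neg_one_mul y).symm
  rw [h]
  exact add_mem hx (complex_smul_mem _ hy)

theorem mem_filtration_zero {x : D q} : x ∈ filtration q 0 ↔ x ∈ Cu q := by
  rw [filtration, Submodule.mem_span_singleton]
  constructor
  · rintro ⟨a, rfl⟩
    simp [Subalgebra.smul_def]
  · intro hx
    exact ⟨⟨x, hx⟩, by simp [Subalgebra.smul_def]⟩

theorem mem_filtration_succ {n : ℕ} {x : D q} : x ∈ filtration q (n + 1) ↔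
    ∃ y ∈ filtration q n, ∃ f g : ℂ[X],
      x = y + (aeval (u q) f * v q ^ (n + 1) + aeval (u q) g * (v q ^ n * w q)) := by
  rw [filtration, Submodule.mem_sup]
  constructor
  · rintro ⟨y, hy, z, hz, rfl⟩
    obtain ⟨⟨a, ha⟩, ⟨b, hb⟩, rfl⟩ := Submodule.mem_span_pair.1 hz
    obtain ⟨f, rfl⟩ := mem_Cu_iff.1 ha
    obtain ⟨g, rfl⟩ := mem_Cu_iff.1 hb
    exact ⟨y, hy, f, g, rfl⟩
  · rintro ⟨y, hy, f, g, rfl⟩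
    exact ⟨y, hy, _, Submodule.mem_span_pair.2
      ⟨⟨_, mem_Cu_iff.2 ⟨f, rfl⟩⟩, ⟨_, mem_Cu_iff.2 ⟨g, rfl⟩⟩, rfl⟩, rfl⟩

theorem aeval_u_mul_mem {n : ℕ} {x : D q} (f : ℂ[X]) (hx : x ∈ filtration q n) :
    aeval (u q) f * x ∈ filtration q n :=
  (filtration q n).smul_mem ⟨_, mem_Cu_iff.2 ⟨f, rfl⟩⟩ hx

/-- To check that right multiplication by `a` maps one step of the filtration into a left
`ℂ[u]`-submodule it suffices to look at the new generators. -/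
theorem mul_mem_of_generators {n : ℕ} {a x : D q} {m : ℕ}
    (h : ∀ y ∈ filtration q n, y * a ∈ filtration q m)
    (hv : v q ^ (n + 1) * a ∈ filtration q m) (hw : v q ^ n * w q * a ∈ filtration q m)
    (hx : x ∈ filtration q (n + 1)) : x * a ∈ filtration q m := by
  obtain ⟨y, hy, f, g, rfl⟩ := mem_filtration_succ.1 hx
  rw [add_mul, add_mul, mul_assoc (aeval (u q) f), mul_assoc (aeval (u q) g)]
  exact add_mem (h y hy) (add_mem (aeval_u_mul_mem f hv) (aeval_u_mul_mem g hw))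

theorem mul_aeval_u_mem {n : ℕ} (h : ∀ x ∈ filtration q n, x * u q ∈ filtration q n)
    (f : ℂ[X]) {x : D q} (hx : x ∈ filtration q n) : x * aeval (u q) f ∈ filtration q n := by
  induction f using Polynomial.induction_on' with
  | add f g hf hg => rw [map_add, mul_add]; exact add_mem hf hg
  | monomial k c =>
    rw [aeval_monomial, ← mul_assoc, ← Algebra.commutes, mul_assoc, ← Algebra.smul_def]
    refine complex_smul_mem c ?_
    induction k with
    | zero => simpa using hx
    | succ k ih => rw [pow_succ, ← mul_assoc]; exact h _ ih

theorem v_pow_succ_mul_u_mem {n : ℕ} (hu : ∀ x ∈ filtration q n, x * u q ∈ filtration q n)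
    (hv : ∀ x ∈ filtration q n, x * v q ∈ filtration q (n + 1)) :
    v q ^ (n + 1) * u q ∈ filtration q (n + 1) := by
  have e : v q ^ (n + 1) * u q
      = v q ^ n * u q * v q - (2 : ℂ) • (v q ^ n * w q) - v q ^ (n + 1) := by
    have h : v q * u q = u q * v q - 2 * w q - v q := by
      rw [sub_sub, ← u_mul_v]; abel
    rw [pow_succ, mul_assoc, h, two_smul]
    simp only [mul_sub, two_mul, mul_add, mul_assoc]
  rw [e]
  exact filtration_sub_mem (filtration_sub_mem (hv _ (hu _ (v_pow_mem n))) (complex_smul_mem 2 (v_pow_mul_w_mem n)))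
    (v_pow_mem _)

/-- The three closures need one joint induction: moving `u` left past degree `n + 1` produces `v`
and `w` multiples of degree `n`, and reducing `w ^ 2` in turn uses closure under `u` one degree up.
-/
theorem filtration_mul_generators (n : ℕ) :
    (∀ x ∈ filtration q n, x * u q ∈ filtration q n) ∧
    (∀ x ∈ filtration q n, x * v q ∈ filtration q (n + 1)) ∧
    (∀ x ∈ filtration q n, x * w q ∈ filtration q (n + 1)) := by
  induction n with
  | zero =>
    refine ⟨fun x hx => ?_, fun x hx => ?_, fun x hx => ?_⟩
    · rw [mem_filtration_zero] at hx ⊢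
      exact mul_mem hx (Algebra.self_mem_adjoin_singleton ℂ _)
    · obtain ⟨f, rfl⟩ := mem_Cu_iff.1 (mem_filtration_zero.1 hx)
      exact aeval_u_mul_mem f (by simpa using v_pow_mem (q := q) 1)
    · obtain ⟨f, rfl⟩ := mem_Cu_iff.1 (mem_filtration_zero.1 hx)
      exact aeval_u_mul_mem f (by simpa using v_pow_mul_w_mem (q := q) 0)
  | succ n ih =>
    obtain ⟨hu, hv, hw⟩ := ih
    have hvu := v_pow_succ_mul_u_mem hu hv
    have hu' : ∀ x ∈ filtration q (n + 1), x * u q ∈ filtration q (n + 1) := by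
      refine fun x => mul_mem_of_generators (fun y hy => filtration_le_succ n (hu y hy)) hvu ?_
      have e : v q ^ n * w q * u q = v q ^ n * u q * w q - (2 : ℂ) • (v q ^ (n + 1) * u q)
          - v q ^ n * w q - rho q • v q ^ n := by
        have h : w q * u q = u q * w q - 2 * (v q * u q) - w q - algebraMap ℂ (D q) (rho q) := by
          rw [sub_sub, sub_sub, ← add_assoc, ← u_mul_w]; abel
        rw [mul_assoc, h, two_smul, Algebra.smul_def, Algebra.commutes, pow_succ]
        simp only [mul_sub, two_mul, mul_add, mul_assoc]
      rw [e]
      exact filtration_sub_mem (filtration_sub_mem (filtration_sub_mem (hw _ (hu _ (v_pow_mem n))) (complex_smul_mem 2 hvu))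
        (v_pow_mul_w_mem n)) (complex_smul_mem _ (filtration_le_succ n (v_pow_mem n)))
    have hv' : ∀ x ∈ filtration q (n + 1), x * v q ∈ filtration q (n + 2) := by
      refine fun x => mul_mem_of_generators (fun y hy => filtration_le_succ _ (hv y hy)) ?_ ?_
      · rw [← pow_succ]; exact v_pow_mem _
      · have e : v q ^ n * w q * v q
            = v q ^ (n + 1) * w q + v q ^ (n + 2) + v q ^ n * aeval (u q) (p1 q) := by
          have h : w q * v q = v q * w q + v q ^ 2 + aeval (u q) (p1 q) := by
            have := v_mul_w q
            rw [sub_eq_iff_eq_add] at this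
            rw [this]; abel
          rw [mul_assoc, h, mul_add, mul_add, ← pow_add, pow_succ (v q) n, mul_assoc]
        rw [e]
        exact add_mem (add_mem (v_pow_mul_w_mem _) (v_pow_mem _))
          (filtration_mono (by omega) (mul_aeval_u_mem hu _ (v_pow_mem n)))
    refine ⟨hu', hv', ?_⟩
    refine fun x => mul_mem_of_generators (fun y hy => filtration_le_succ _ (hw y hy))
      (v_pow_mul_w_mem _) ?_
    have e : v q ^ n * w q * w q = v q ^ (n + 2) * u q + v q ^ (n + 1) * w q
        + rho q • v q ^ (n + 1) + v q ^ n * aeval (u q) (p0 q) := by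
      rw [mul_assoc, ← pow_two, w_sq, mul_add, mul_add, mul_add, mul_smul_comm, pow_add,
        pow_succ (v q) n]
      simp only [mul_assoc]
    rw [e]
    exact add_mem (add_mem (add_mem (v_pow_succ_mul_u_mem hu' hv') (v_pow_mul_w_mem _))
      (complex_smul_mem _ (filtration_le_succ _ (v_pow_mem _))))
      (filtration_mono (by omega) (mul_aeval_u_mem hu _ (v_pow_mem n)))

theorem exists_mem_filtration (x : D q) : ∃ n, x ∈ filtration q n := by
  obtain ⟨a, rfl⟩ := RingQuot.mkAlgHom_surjective ℂ (Rel q) x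
  -- Starting from an arbitrary filtered `y` rather than `1` lets products be absorbed one factor at
  -- a time.
  suffices h : ∀ n, ∀ y ∈ filtration q n, ∃ m, y * RingQuot.mkAlgHom ℂ (Rel q) a ∈ filtration q m by
    simpa using h 0 1 (mem_filtration_zero.2 (one_mem _))
  induction a using FreeAlgebra.induction with
  | grade0 c =>
    intro n y hy
    refine ⟨n, ?_⟩
    rw [AlgHom.commutes, ← Algebra.commutes, ← Algebra.smul_def]
    exact complex_smul_mem c hy
  | grade1 g =>
    intro n y hy
    obtain ⟨hu, hv, hw⟩ := filtration_mul_generators (q := q) n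
    cases g with
    | u => exact ⟨n, hu y hy⟩
    | v => exact ⟨n + 1, hv y hy⟩
    | w => exact ⟨n + 1, hw y hy⟩
  | mul a b ha hb =>
    intro n y hy
    obtain ⟨m, hm⟩ := ha n y hy
    rw [map_mul, ← mul_assoc]
    exact hb m _ hm
  | add a b ha hb =>
    intro n y hy
    obtain ⟨m, hm⟩ := ha n y hy
    obtain ⟨k, hk⟩ := hb n y hy
    rw [map_add, mul_add]
    exact ⟨max m k, add_mem (filtration_mono (le_max_left _ _) hm)
      (filtration_mono (le_max_right _ _) hk)⟩

end Filtration

/-! ### The representation by difference operators on `i + ℤ`. -/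

section Representation

/-- The points `i + n` of the lattice on which `D(q)` is represented by difference operators. -/
def node (n : ℤ) : ℂ := Complex.I + n

theorem node_add (n m : ℤ) : node (n + m) = node n + m := by
  simp [node, add_assoc]

theorem node_sub (n m : ℤ) : node (n - m) = node n - m := by
  simp [node, add_sub_assoc]

/-- The coefficient of the constant term of the operator `opV`. -/
def midCoeff (q : ℂ[X]) (s : ℂ) : ℂ := 2 * rho q / ((1 - 2 * s) * (1 + 2 * s))

/-- The coefficient of the downward shift of the operator `opV`. -/
def downCoeff (q : ℂ[X]) (s : ℂ) : ℂ :=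
  q.eval (s - 1) * q.eval (-s) / (s * (s - 1) * (2 * s - 1) ^ 2)

/-- The operator representing `u`. -/
def opU : Module.End ℂ (ℤ → ℂ) where
  toFun f n := node n ^ 2 * f n
  map_add' f g := by ext n; simp only [Pi.add_apply]; ring
  map_smul' c f := by ext n; simp only [Pi.smul_apply, smul_eq_mul, RingHom.id_apply]; ring

/-- The operator representing `v`. -/
def opV (q : ℂ[X]) : Module.End ℂ (ℤ → ℂ) where
  toFun f n := f (n + 1) + midCoeff q (node n) * f n + downCoeff q (node n) * f (n - 1)
  map_add' f g := by ext n; simp only [Pi.add_apply]; ring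
  map_smul' c f := by ext n; simp only [Pi.smul_apply, smul_eq_mul, RingHom.id_apply]; ring

/-- The operator representing `w`. -/
def opW (q : ℂ[X]) : Module.End ℂ (ℤ → ℂ) where
  toFun f n := -(node n + 1) * f (n + 1) - midCoeff q (node n) / 2 * f n
    + (node n - 1) * downCoeff q (node n) * f (n - 1)
  map_add' f g := by ext n; simp only [Pi.add_apply]; ring
  map_smul' c f := by ext n; simp only [Pi.smul_apply, smul_eq_mul, RingHom.id_apply]; ring

variable (q : ℂ[X])

theorem opU_apply (f : ℤ → ℂ) (n : ℤ) : opU f n = node n ^ 2 * f n := rfl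

theorem opV_apply (f : ℤ → ℂ) (n : ℤ) : opV q f n =
    f (n + 1) + midCoeff q (node n) * f n + downCoeff q (node n) * f (n - 1) := rfl

theorem opW_apply (f : ℤ → ℂ) (n : ℤ) : opW q f n =
    -(node n + 1) * f (n + 1) - midCoeff q (node n) / 2 * f n
      + (node n - 1) * downCoeff q (node n) * f (n - 1) := rfl

theorem aeval_opU_apply (p : ℂ[X]) (f : ℤ → ℂ) (n : ℤ) :
    aeval opU p f n = p.eval (node n ^ 2) * f n := by
  induction p using Polynomial.induction_on' with
  | add p r hp hr => simp [hp, hr, add_mul]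
  | monomial k c =>
    have h : (opU ^ k) f n = (node n ^ 2) ^ k * f n := by
      induction k with
      | zero => simp
      | succ k ih => rw [pow_succ', Module.End.mul_apply, opU_apply, ih]; ring
    simp [aeval_monomial, Module.algebraMap_end_apply, h, mul_assoc]

theorem eval_p0_add (s : ℂ) :
    ((p0 q).eval (s ^ 2) + (p1 q).eval (s ^ 2) * s) * (1 + 2 * s) ^ 2
      = -4 * q.eval s * q.eval (-s - 1) + rho q ^ 2 := by
  have h := congrArg (eval s) (pPoly_mul q)
  rw [pPoly_eq] at h
  simpa using h

variable {q}

theorem midCoeff_mul {s : ℂ} (h₁ : 1 - 2 * s ≠ 0) (h₂ : 1 + 2 * s ≠ 0) :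
    midCoeff q s * ((1 - 2 * s) * (1 + 2 * s)) = 2 * rho q :=
  div_mul_cancel₀ _ (mul_ne_zero h₁ h₂)

theorem midCoeff_step {s : ℂ} (h₁ : 1 - 2 * s ≠ 0) (h₂ : 1 + 2 * s ≠ 0) (h₃ : 3 + 2 * s ≠ 0) :
    midCoeff q (s + 1) * (s + 3 / 2) = midCoeff q s * (s - 1 / 2) := by
  have h₄ : 1 - 2 * (s + 1) ≠ 0 := by
    rw [show 1 - 2 * (s + 1) = -(1 + 2 * s) by ring]; exact neg_ne_zero.2 h₂
  have h₅ : 1 + 2 * (s + 1) ≠ 0 := by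
    rw [show 1 + 2 * (s + 1) = 3 + 2 * s by ring]; exact h₃
  have e₁ := midCoeff_mul (q := q) h₁ h₂
  have e₂ := midCoeff_mul (q := q) h₄ h₅
  apply mul_right_cancel₀ h₂
  linear_combination (-1 / 2 : ℂ) * e₂ + (1 / 2 : ℂ) * e₁

theorem downCoeff_mul {s : ℂ} (h₀ : s ≠ 0) (h₁ : s - 1 ≠ 0) (h₂ : 2 * s - 1 ≠ 0) :
    downCoeff q s * (s * (s - 1) * (2 * s - 1) ^ 2) = q.eval (s - 1) * q.eval (-s) :=
  div_mul_cancel₀ _ (mul_ne_zero (mul_ne_zero h₀ h₁) (pow_ne_zero _ h₂))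

/-- The value `p(s)` in terms of the operator coefficients: `downCoeff` carries the product `q(s)
q(-s-1)` and `midCoeff` the term `ρ²`. With the analogous formula for `p(-s)`, half the sum and half
the difference recover `p₀(s²)` and `s p₁(s²)`. -/
theorem eval_p_eq {s : ℂ} (h₀ : s ≠ 0) (h₁ : s + 1 ≠ 0) (h₂ : 1 - 2 * s ≠ 0) (h₃ : 1 + 2 * s ≠ 0) :
    (p0 q).eval (s ^ 2) + (p1 q).eval (s ^ 2) * s =
      -4 * s * (s + 1) * downCoeff q (s + 1) + midCoeff q s ^ 2 * (1 - 2 * s) ^ 2 / 4 := by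
  have h := eval_p0_add q s
  have hd := downCoeff_mul (q := q) (s := s + 1) h₁ (by simpa using h₀)
    (by convert h₃ using 1; ring)
  have hm := midCoeff_mul (q := q) h₂ h₃
  rw [show s + 1 - 1 = s by ring, show -(s + 1) = -s - 1 by ring] at hd
  apply mul_right_cancel₀ (pow_ne_zero 2 h₃)
  linear_combination h + 4 * hd
    - (midCoeff q s * ((1 - 2 * s) * (1 + 2 * s)) + 2 * rho q) / 4 * hm

theorem eval_p_neg_eq {s : ℂ} (h₀ : s ≠ 0) (h₁ : s - 1 ≠ 0) (h₂ : 1 - 2 * s ≠ 0)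
    (h₃ : 1 + 2 * s ≠ 0) :
    (p0 q).eval (s ^ 2) - (p1 q).eval (s ^ 2) * s =
      -4 * s * (s - 1) * downCoeff q s + midCoeff q s ^ 2 * (1 + 2 * s) ^ 2 / 4 := by
  have h := eval_p0_add q (-s)
  have hd := downCoeff_mul (q := q) (s := s) h₀ h₁
    (by rw [← neg_ne_zero]; convert h₂ using 1; ring)
  have hm := midCoeff_mul (q := q) h₂ h₃
  rw [neg_sq, show - -s - 1 = s - 1 by ring] at h
  apply mul_right_cancel₀ (pow_ne_zero 2 h₂)
  linear_combination h + 4 * hd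
    - (midCoeff q s * ((1 - 2 * s) * (1 + 2 * s)) + 2 * rho q) / 4 * hm

/-- The offset `i` keeps the lattice off the real axis, where all poles of the coefficients lie. -/
theorem node_nonsingular (n : ℤ) : node n ≠ 0 ∧ node n + 1 ≠ 0 ∧ node n - 1 ≠ 0 ∧
    1 - 2 * node n ≠ 0 ∧ 1 + 2 * node n ≠ 0 ∧ 3 + 2 * node n ≠ 0 := by
  refine ⟨?_, ?_, ?_, ?_, ?_, ?_⟩ <;> intro h <;>
    simpa [node] using congrArg Complex.im h

theorem eval_p1_node (n : ℤ) : (p1 q).eval (node n ^ 2) =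
    -2 * (node n + 1) * downCoeff q (node n + 1) + 2 * (node n - 1) * downCoeff q (node n)
      - midCoeff q (node n) ^ 2 := by
  obtain ⟨h₀, h₁, h₂, h₃, h₄, -⟩ := node_nonsingular n
  have e₁ := eval_p_eq (q := q) h₀ h₁ h₃ h₄
  have e₂ := eval_p_neg_eq (q := q) h₀ h₂ h₃ h₄
  apply mul_right_cancel₀ h₀
  linear_combination (e₁ - e₂) / 2

theorem eval_p0_node (n : ℤ) : (p0 q).eval (node n ^ 2) =
    -2 * node n * (node n + 1) * downCoeff q (node n + 1)
      - 2 * node n * (node n - 1) * downCoeff q (node n)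
      + midCoeff q (node n) ^ 2 * (1 + 4 * node n ^ 2) / 4 := by
  obtain ⟨h₀, h₁, h₂, h₃, h₄, -⟩ := node_nonsingular n
  have e₁ := eval_p_eq (q := q) h₀ h₁ h₃ h₄
  have e₂ := eval_p_neg_eq (q := q) h₀ h₂ h₃ h₄
  linear_combination (e₁ + e₂) / 2

theorem midCoeff_node_add (n : ℤ) :
    midCoeff q (node n + 1) * (node n + 3 / 2) = midCoeff q (node n) * (node n - 1 / 2) := by
  obtain ⟨-, -, -, h₃, h₄, h₅⟩ := node_nonsingular n
  exact midCoeff_step h₃ h₄ h₅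

theorem midCoeff_node_sub (n : ℤ) :
    midCoeff q (node n) * (node n + 1 / 2) = midCoeff q (node n - 1) * (node n - 3 / 2) := by
  have := midCoeff_node_add (q := q) (n - 1)
  rw [node_sub, Int.cast_one] at this
  convert this using 2 <;> ring_nf

theorem opU_opV : opU * opV q - opV q * opU = 2 * opW q + opV q := by
  ext1 f; ext n
  simp only [two_mul, LinearMap.sub_apply, LinearMap.add_apply, Module.End.mul_apply, Pi.sub_apply,
    Pi.add_apply, opU_apply, opV_apply, opW_apply, node_add, node_sub, Int.cast_one]
  ring

theorem opU_opW : opU * opW q - opW q * opU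
    = 2 * (opV q * opU) + opW q + algebraMap ℂ (Module.End ℂ (ℤ → ℂ)) (rho q) := by
  ext1 f; ext n
  obtain ⟨-, -, -, h₃, h₄, -⟩ := node_nonsingular n
  simp only [two_mul, LinearMap.sub_apply, LinearMap.add_apply, Module.End.mul_apply, Pi.sub_apply,
    Pi.add_apply, opU_apply, opV_apply, opW_apply, node_add, node_sub, Int.cast_one,
    Module.algebraMap_end_apply, Pi.smul_apply, smul_eq_mul]
  linear_combination (1 / 2 : ℂ) * f n * midCoeff_mul (q := q) h₃ h₄

/-- Comparing coefficients of shifts: those by `±2` agree identically, those by `±1` reduce to the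
recurrence for `midCoeff`, and the unshifted one is the formula for `p₁`. -/
theorem opV_opW : opV q * opW q - opW q * opV q = -opV q ^ 2 - aeval opU (p1 q) := by
  ext1 f; ext n
  simp only [pow_two, LinearMap.sub_apply, LinearMap.neg_apply, Module.End.mul_apply, Pi.sub_apply,
    Pi.neg_apply, aeval_opU_apply, opV_apply, opW_apply, node_add, node_sub, Int.cast_one,
    add_sub_cancel_right, sub_add_cancel]
  have h1 := eval_p1_node (q := q) n
  rw [pow_two] at h1
  rw [h1]
  linear_combination f (n + 1) * midCoeff_node_add (q := q) n
    + downCoeff q (node n) * f (n - 1) * midCoeff_node_sub (q := q) n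

theorem opW_sq : opW q ^ 2
    = opV q ^ 2 * opU + opV q * opW q + rho q • opV q + aeval opU (p0 q) := by
  ext1 f; ext n
  obtain ⟨-, -, -, h₃, h₄, -⟩ := node_nonsingular n
  have hm := midCoeff_mul (q := q) h₃ h₄
  simp only [pow_two, LinearMap.add_apply, LinearMap.smul_apply, Module.End.mul_apply, Pi.add_apply,
    Pi.smul_apply, smul_eq_mul, aeval_opU_apply, opU_apply, opV_apply, opW_apply, node_add,
    node_sub, Int.cast_one, add_sub_cancel_right, sub_add_cancel]
  have h0 := eval_p0_node (q := q) n
  rw [pow_two] at h0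
  rw [h0]
  have ha := midCoeff_node_add (q := q) n
  have hs := midCoeff_node_sub (q := q) n
  linear_combination f (n + 1) * (hm / 2 - node n * ha)
    + downCoeff q (node n) * f (n - 1) * (hm / 2 + node n * hs)
    + f n * midCoeff q (node n) / 2 * hm

/-- The representation of `D(q)` by difference operators. -/
def rep (q : ℂ[X]) : D q →ₐ[ℂ] Module.End ℂ (ℤ → ℂ) :=
  RingQuot.liftAlgHom ℂ ⟨FreeAlgebra.lift ℂ (fun g : Gen => match g with
    | .u => opU
    | .v => opV q
    | .w => opW q), by
    intro a b h
    cases h with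
    | uv => simpa [two_mul] using opU_opV (q := q)
    | uw => simpa [two_mul] using opU_opW (q := q)
    | vw => simpa [← aeval_algHom_apply] using opV_opW
    | ww => simpa [← aeval_algHom_apply] using opW_sq⟩

theorem rep_u : rep q (u q) = opU := by simp [rep, u]

theorem rep_v : rep q (v q) = opV q := by simp [rep, v]

theorem rep_w : rep q (w q) = opW q := by simp [rep, w]

theorem rep_aeval_u (p : ℂ[X]) (f : ℤ → ℂ) (n : ℤ) :
    rep q (aeval (u q) p) f n = p.eval (node n ^ 2) * f n := by
  rw [← aeval_algHom_apply, rep_u, aeval_opU_apply]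

end Representation

/-! ### Leading coefficients and the centralizer of `u`. -/

section Commutant

variable {q : ℂ[X]}

/-- The term `f (n + 1)` of `opV`, with coefficient `1`, moves the lower end of the support down by
one and preserves the value there. -/
theorem opV_pow_support {f : ℤ → ℂ} {m : ℤ} (hf : ∀ k < m, f k = 0) (j : ℕ) :
    (opV q ^ j) f (m - j) = f m ∧ ∀ k < m - j, (opV q ^ j) f k = 0 := by
  induction j with
  | zero => simpa using hf
  | succ j ih =>
    obtain ⟨h₁, h₂⟩ := ih
    rw [pow_succ']
    simp only [Module.End.mul_apply, opV_apply]
    push_cast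
    refine ⟨?_, fun k hk => ?_⟩
    · rw [show m - (j + 1 : ℤ) + 1 = m - j by ring, h₁, h₂ _ (by omega), h₂ _ (by omega)]
      ring
    · rw [h₂ _ (by omega), h₂ _ (by omega), h₂ _ (by omega)]
      ring

theorem opW_single_support (m : ℤ) : opW q (Pi.single m 1) (m - 1) = -node m ∧
    ∀ k < m - 1, opW q (Pi.single m 1) k = 0 := by
  simp only [opW_apply]
  refine ⟨?_, fun k hk => ?_⟩
  · have h : (Pi.single m (1 : ℂ) : ℤ → ℂ) (m - 1 - 1) = 0 := Pi.single_eq_of_ne (by omega) _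
    simp [node_sub, h]
  · rw [Pi.single_eq_of_ne (by omega), Pi.single_eq_of_ne (by omega),
      Pi.single_eq_of_ne (by omega)]
    ring

theorem single_support (m : ℤ) : ∀ k < m, (Pi.single m (1 : ℂ) : ℤ → ℂ) k = 0 :=
  fun _ hk => Pi.single_eq_of_ne hk.ne _

theorem rep_v_pow_single (m : ℤ) (j : ℕ) :
    rep q (v q ^ j) (Pi.single m 1) (m - j) = 1 ∧
      ∀ k < m - j, rep q (v q ^ j) (Pi.single m 1) k = 0 := by
  rw [map_pow, rep_v]
  simpa using opV_pow_support (q := q) (single_support m) j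

theorem rep_v_pow_mul_w_single (m : ℤ) (j : ℕ) :
    rep q (v q ^ j * w q) (Pi.single m 1) (m - (j + 1 : ℕ)) = -node m ∧
      ∀ k < m - (j + 1 : ℕ), rep q (v q ^ j * w q) (Pi.single m 1) k = 0 := by
  obtain ⟨h₁, h₂⟩ := opW_single_support (q := q) m
  have h := opV_pow_support (q := q) h₂ j
  rw [map_mul, map_pow, rep_v, rep_w, Module.End.mul_apply]
  rw [h₁, show m - 1 - (j : ℤ) = m - (j + 1 : ℕ) by push_cast; ring] at h
  exact h

/-- Degree bounds how far down supports can move, so lower-order terms do not reach the point where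
the leading coefficient is read. -/
theorem rep_single_eq_zero {n : ℕ} {x : D q} (hx : x ∈ filtration q n) {m k : ℤ} (hk : k < m - n) :
    rep q x (Pi.single m 1) k = 0 := by
  induction n generalizing x with
  | zero =>
    obtain ⟨f, rfl⟩ := mem_Cu_iff.1 (mem_filtration_zero.1 hx)
    rw [rep_aeval_u, single_support m k (by simpa using hk), mul_zero]
  | succ n ih =>
    obtain ⟨y, hy, f, g, rfl⟩ := mem_filtration_succ.1 hx
    simp only [map_add, map_mul _ (aeval (u q) _), LinearMap.add_apply, Module.End.mul_apply,
      Pi.add_apply, rep_aeval_u]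
    rw [ih hy (by push_cast at hk; omega), (rep_v_pow_single m (n + 1)).2 k hk,
      (rep_v_pow_mul_w_single m n).2 k hk]
    ring

/-- Commuting with `u` preserves its eigenspaces, and each delta function spans one. -/
theorem rep_single_eq_zero_of_commute {x : D q} (hx : Commute x (u q)) {m k : ℤ} (hk : k ≠ m) :
    rep q x (Pi.single m 1) k = 0 := by
  have h := congrArg (fun y => rep q y (Pi.single m 1) k) hx.eq
  have hs : opU (Pi.single m 1) = node m ^ 2 • (Pi.single m 1 : ℤ → ℂ) := by
    ext j
    rcases eq_or_ne j m with rfl | hj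
    · simp [opU_apply]
    · simp [opU_apply, hj]
  simp only [map_mul, Module.End.mul_apply, rep_u, hs, map_smul, Pi.smul_apply, smul_eq_mul,
    opU_apply] at h
  -- The factor `node k + node m` has imaginary part `2`, and `node k - node m` is the integer `k -
  -- m`.
  have h₁ : node k ^ 2 - node m ^ 2 ≠ 0 := by
    rw [sq_sub_sq]
    refine mul_ne_zero (fun h => ?_) (fun h => hk ?_)
    · have := congrArg Complex.im h
      norm_num [node] at this
    · simpa [node, sub_eq_zero] using h
  refine (mul_eq_zero.1 ?_).resolve_left h₁
  linear_combination -h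

theorem infinite_range_node : (Set.range node).Infinite :=
  Set.infinite_range_of_injective fun a b h => by simpa [node] using h

theorem eq_zero_of_eval_node {f g : ℂ[X]} {c : ℂ}
    (h : ∀ n, f.eval (node n ^ 2) = g.eval (node n ^ 2) * (node n + c)) : f = 0 ∧ g = 0 := by
  have hp : f.comp (X ^ 2) = g.comp (X ^ 2) * (X + C c) := by
    refine eq_of_infinite_eval_eq _ _ (infinite_range_node.mono ?_)
    rintro _ ⟨n, rfl⟩
    simpa using h n
  have he : ∀ z : ℂ, f.eval (z ^ 2) = g.eval (z ^ 2) * (z + c) := fun z => by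
    simpa using congrArg (eval z) hp
  -- Subtracting the identities at `z` and `-z` isolates the odd part `g(z²) z`.
  have hg₁ : g.comp (X ^ 2) * X = 0 := by
    refine Polynomial.funext fun z => ?_
    have h₁ := he z
    have h₂ := he (-z)
    rw [neg_sq] at h₂
    simp only [eval_mul, eval_comp, eval_pow, eval_X, eval_zero]
    linear_combination (h₂ - h₁) / 2
  have inj : ∀ r : ℂ[X], r.comp (X ^ 2) = 0 → r = 0 := fun r hr => by
    rw [← expand_eq_comp_X_pow] at hr
    exact (expand_eq_zero two_pos).1 hr
  have hg : g.comp (X ^ 2) = 0 := (mul_eq_zero.1 hg₁).resolve_right X_ne_zero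
  refine ⟨inj f ?_, inj g hg⟩
  rw [hp, hg, zero_mul]

theorem mem_Cu_of_commute {x : D q} (hx : Commute x (u q)) : x ∈ Cu q := by
  obtain ⟨n, hn⟩ := exists_mem_filtration x
  induction n with
  | zero => exact mem_filtration_zero.1 hn
  | succ n ih =>
    obtain ⟨y, hy, f, g, rfl⟩ := mem_filtration_succ.1 hn
    have key : ∀ k, f.eval (node k ^ 2) = g.eval (node k ^ 2) * (node k + (n + 1 : ℕ)) := by
      intro k
      -- The delta function is placed at `m = k + n + 1`, so that `k` is the lowest point reachable
      -- in degree `n + 1`; there `v ^ (n + 1)` contributes `1` and `v ^ n * w` contributes `-node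
      -- m`.
      obtain ⟨m, rfl⟩ : ∃ m : ℤ, k = m - (n + 1 : ℕ) := ⟨k + (n + 1 : ℕ), by ring⟩
      have h := rep_single_eq_zero_of_commute hx
        (show m - ((n + 1 : ℕ) : ℤ) ≠ m by omega)
      simp only [map_add, map_mul _ (aeval (u q) _), LinearMap.add_apply, Module.End.mul_apply,
        Pi.add_apply, rep_aeval_u] at h
      rw [rep_single_eq_zero hy (by omega), (rep_v_pow_single m (n + 1)).1,
        (rep_v_pow_mul_w_single m n).1] at h
      have e : node m = node (m - (n + 1 : ℕ)) + (n + 1 : ℕ) := by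
        rw [node_sub]; push_cast; ring
      rw [e] at h
      linear_combination h
    obtain ⟨rfl, rfl⟩ := eq_zero_of_eval_node key
    refine ih ?_
    simpa using hy

end Commutant

end

end KleinianD

theorem mainTheorem7 (q : Polynomial ℂ) (hq : 4 ≤ q.natDegree) :
    KleinianD.IsMaximalCommutative (KleinianD.Cu q) := by
  refine ⟨⟨⟨?_⟩⟩, fun S hS hle x hx => KleinianD.mem_Cu_of_commute ?_⟩
  · rintro ⟨a, ha⟩ ⟨b, hb⟩
    obtain ⟨f, rfl⟩ := KleinianD.mem_Cu_iff.1 ha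
    obtain ⟨g, rfl⟩ := KleinianD.mem_Cu_iff.1 hb
    refine Subtype.ext ?_
    change Polynomial.aeval (KleinianD.u q) f * Polynomial.aeval (KleinianD.u q) g
      = Polynomial.aeval (KleinianD.u q) g * Polynomial.aeval (KleinianD.u q) f
    rw [← map_mul, mul_comm, map_mul]
  · have hu : KleinianD.u q ∈ S := hle (Algebra.self_mem_adjoin_singleton ℂ _)
    exact congrArg Subtype.val (hS.is_comm.comm (⟨x, hx⟩ : S) ⟨_, hu⟩)
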